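/- Let $R$ be an associative, not necessarily commutative ring with identity, and let $\alpha$ be a ring endomorphism of $R$ (preserving $1$). Write $U(R)$ for the group of units of $R$, $\mathrm{Nil}(R)$ for its set of nilpotent elements, $L(R)$ for its Levitzki radical (the sum of all locally nilpotent two-sided ideals), and $\Delta(R)=\{r\in R : r+u\in U(R)\text{ for all }u\in U(R)\}$. The ring $R$ is called W$\Delta$U if $U(R)=\pm 1+\Delta(R)$, that is, if the units of $R$ are exactly the elements of the form $1+d$ or $-1+d$ with $d\in\Delta(R)$; it is called weakly $2$-primal if $\mathrm{Nil}(R)=L(R)$; and it is called $\alpha$-compatible if, for all $a,b\in R$, $ab=0$ if and only if $a\alpha(b)=0$. Let $R[x;\alpha]$ be the skew polynomial ring, whose elements are the polynomials $\sum_i a_ix^i$ with $a_i\in R$ and whose multiplication is determined by $xr=\alpha(r)x$ for $r\in R$. Let $L(R)[x;\alpha]$ be the set of those skew polynomials all of whose coefficients lie in $L(R)$. Suppose that $R$ is weakly $2$-primal and $\alpha$-compatible. Then $$\Delta(R[x;\alpha])=\Delta(R)+L(R)[x;\alpha]\,x,$$ and $R[x;\alpha]$ is a W$\Delta$U ring if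 and only if $R$ is a W$\Delta$U ring. -/

import Mathlib

noncomputable section

/-- `Δ(R)`, the set of all `r` such that `r + u` is a unit for every unit `u` of `R`. -/
def deltaSet (R : Type*) [Ring R] : Set R :=
  {r | ∀ u : R, IsUnit u → IsUnit (r + u)}

/-- `R` is a weakly `ΔU` ring: `U(R) = ±1 + Δ(R)`, that is, the units of `R` are exactly
the elements of the form `1 + d` or `-1 + d` with `d ∈ Δ(R)`. -/
def IsWeaklyDeltaU (R : Type*) [Ring R] : Prop :=
  {u : R | IsUnit u} = {u : R | ∃ d ∈ deltaSet R, u = 1 + d ∨ u = -1 + d}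

/-- A two-sided ideal is locally nilpotent if each of its finite subsets `s` is nilpotent:
for some `n`, every product of `n` elements of `s` (with repetitions) vanishes. -/
def IsLocallyNilpotentIdeal {R : Type*} [Ring R] (I : TwoSidedIdeal R) : Prop :=
  ∀ s : Finset R, (∀ a ∈ s, a ∈ I) →
    ∃ n : ℕ, ∀ l : List R, l.length = n → (∀ a ∈ l, a ∈ s) → l.prod = 0

/-- The Levitzki radical `L(R)`: the sum of all locally nilpotent two-sided ideals. -/
def levitzkiRadical (R : Type*) [Ring R] : TwoSidedIdeal R :=
  sSup {I : TwoSidedIdeal R | IsLocallyNilpotentIdeal I}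

/-- `R` is weakly 2-primal: `Nil(R) = L(R)`. -/
def IsWeaklyTwoPrimal (R : Type*) [Ring R] : Prop :=
  {a : R | IsNilpotent a} = {a : R | a ∈ levitzkiRadical R}

/-- `R` is `α`-compatible: `ab = 0 ↔ a α(b) = 0` for all `a`, `b`. -/
def IsCompatible {R : Type*} [Ring R] (α : R →+* R) : Prop :=
  ∀ a b : R, a * b = 0 ↔ a * α b = 0

/-- The action of `ℕ` (written multiplicatively) on `R` by the iterates of `α`. -/
@[reducible]
def iterateAction {R : Type*} [Ring R] (α : R →+* R) :
    MulSemiringAction (Multiplicative ℕ) R where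
  smul n r := (α ^ n.toAdd) r
  one_smul _ := rfl
  mul_smul m n r := by
    change (α ^ (m.toAdd + n.toAdd)) r = (α ^ m.toAdd) ((α ^ n.toAdd) r)
    rw [pow_add]; rfl
  smul_zero n := map_zero (α ^ n.toAdd)
  smul_add n := map_add (α ^ n.toAdd)
  smul_one n := map_one (α ^ n.toAdd)
  smul_mul n := map_mul (α ^ n.toAdd)

/-- The skew polynomial ring `R[x; α]`: Mathlib's skew polynomials over `R`, where the
multiplication is twisted by `α`. -/
def SkewPolyRing {R : Type*} [Ring R] (_α : R →+* R) : Type _ := SkewPolynomial R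

namespace SkewPolyRing

variable {R : Type*} [Ring R] (α : R →+* R)

instance : Ring (SkewPolyRing α) :=
  letI := iterateAction α
  inferInstanceAs (Ring (SkewPolynomial R))

/-- The embedding of `R` into `R[x; α]` as constants. -/
def C : R →+* SkewPolyRing α :=
  letI := iterateAction α
  (SkewPolynomial.CRingHom : R →+* SkewPolynomial R)

/-- The variable `x`. -/
def X : SkewPolyRing α := (SkewPolynomial.X : SkewPolynomial R)

variable {α} in
/-- The coefficient of `xⁿ` in a skew polynomial with coefficients written on the left. -/
def coeff (f : SkewPolyRing α) (n : ℕ) : R := SkewPolynomial.coeff (R := R) f n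

/-- The defining relation `x r = α(r) x`. -/
theorem X_mul_C (r : R) : X α * C α r = C α (α r) * X α := by
  let _ := iterateAction α
  have h1 : (SkewPolynomial.X : SkewPolynomial R) * SkewPolynomial.C r
      = SkewPolynomial.C (α r) * SkewPolynomial.X := by
    rw [SkewPolynomial.C_mul_X_eq_monomial]
    exact (SkewPolynomial.monomial_mul_monomial 1 0 1 r).trans (by simp; rfl)
  exact h1

/-- The coefficients of `a xⁿ`. -/
theorem coeff_C_mul_X_pow (a : R) (n m : ℕ) :
    coeff (C α a * X α ^ n) m = if n = m then a else 0 := by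
  let _ := iterateAction α
  have h1 : (SkewPolynomial.C a * SkewPolynomial.X ^ n : SkewPolynomial R).coeff m
      = if n = m then a else 0 := by
    rw [SkewPolynomial.C_mul_X_pow_eq_monomial, SkewPolynomial.coeff_monomial]
  exact h1

end SkewPolyRing

end

/-! ### Local nilpotence of the Levitzki radical. -/

section LocallyNilpotent

open scoped Pointwise

variable {R : Type*} [Ring R]

/-! Everything follows from the description of units in `SkewPolyRing.isUnit_iff`: invertible
constant term, all other coefficients in `L(R)`. Membership in `Δ` is then tested coefficientwise
(`mem_deltaSet_iff`), and shifting by `±1` changes only the constant term. Since `Nil(R) = L(R)`,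
the quotient `R/L(R)` is reduced, and compatibility persists modulo `L(R)`. The Armendariz argument
(`coeff_mul_coeff_mem`) then turns `fg = 1` into `aᵢ bⱼ ∈ L(R)` for `i + j ≠ 0`; take `j = 0`.
Conversely, such an `f` is `u (1 + nilpotent)` with `u` its constant term, by
`isNilpotent_of_coeff_mem`. -/

theorem List.prod_sub_map_prod_mem {I : TwoSidedIdeal R} (z : R → R) :
    ∀ l : List R, (∀ a ∈ l, a - z a ∈ I) → l.prod - (l.map z).prod ∈ I
  | [], _ => by simp [I.zero_mem]
  | a :: l, h => by
    have h1 := List.prod_sub_map_prod_mem z l fun b hb => h b (List.mem_cons_of_mem _ hb)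
    have h2 := h a List.mem_cons_self
    have : (a :: l).prod - ((a :: l).map z).prod
        = (a - z a) * l.prod + z a * (l.prod - (l.map z).prod) := by
      simp only [List.prod_cons, List.map_cons]; noncomm_ring
    rw [this]
    exact I.add_mem (I.mul_mem_right _ _ h2) (I.mul_mem_left _ _ h1)

theorem List.prod_mem_finset_pow [DecidableEq R] {s : Finset R} :
    ∀ l : List R, (∀ a ∈ l, a ∈ s) → l.prod ∈ s ^ l.length
  | [], _ => by simp
  | a :: l, h => by
    rw [List.prod_cons, List.length_cons, pow_succ']
    exact Finset.mul_mem_mul (h a List.mem_cons_self)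
      (List.prod_mem_finset_pow l fun b hb => h b (List.mem_cons_of_mem _ hb))

/-- A product of `m * n` elements of `s` is a product of `m` elements of `s ^ n`. -/
theorem List.exists_prod_eq_of_finset_pow [DecidableEq R] {s : Finset R} (n : ℕ) :
    ∀ (m : ℕ) (l : List R), l.length = m * n → (∀ a ∈ l, a ∈ s) →
      ∃ l' : List R, l'.length = m ∧ (∀ a ∈ l', a ∈ s ^ n) ∧ l'.prod = l.prod
  | 0, l, hl, _ => ⟨[], rfl, by simp, by
      rw [List.eq_nil_of_length_eq_zero (hl.trans (zero_mul n))]⟩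
  | m + 1, l, hl, h => by
    rw [add_mul, one_mul] at hl
    obtain ⟨l', h1, h2, h3⟩ := List.exists_prod_eq_of_finset_pow n m (l.drop n)
      (by rw [List.length_drop, hl]; omega) fun a ha => h a (List.mem_of_mem_drop ha)
    refine ⟨(l.take n).prod :: l', by simp [h1], ?_, ?_⟩
    · intro a ha
      rcases List.mem_cons.1 ha with rfl | ha
      · have := List.prod_mem_finset_pow (l.take n) fun a ha => h a (List.mem_of_mem_take ha)
        rwa [List.length_take, min_eq_left (by omega)] at this
      · exact h2 a ha
    · rw [List.prod_cons, h3, List.prod_take_mul_prod_drop]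

/-- Modulo `I`, each element of `s` equals an element of `J`, so for some `n` all products of `n`
elements of `s` lie in `I`. They form the finite set `s ^ n`, which is nilpotent in turn. -/
theorem IsLocallyNilpotentIdeal.sup {I J : TwoSidedIdeal R} (hI : IsLocallyNilpotentIdeal I)
    (hJ : IsLocallyNilpotentIdeal J) : IsLocallyNilpotentIdeal (I ⊔ J) := by
  classical
  intro s hs
  have hz : ∀ a, ∃ z, a ∈ s → z ∈ J ∧ a - z ∈ I := by
    intro a
    by_cases ha : a ∈ s
    · obtain ⟨y, hy, z, hz, rfl⟩ := TwoSidedIdeal.mem_sup.1 (hs a ha)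
      exact ⟨z, fun _ => ⟨hz, by simpa using hy⟩⟩
    · exact ⟨0, fun h => absurd h ha⟩
  choose z hz using hz
  obtain ⟨n, hn⟩ := hJ (s.image z) (by
    intro a ha
    obtain ⟨b, hb, rfl⟩ := Finset.mem_image.1 ha
    exact (hz b hb).1)
  obtain ⟨m, hm⟩ := hI (s ^ n) (by
    intro a ha
    obtain ⟨f, rfl⟩ := Finset.mem_pow.1 ha
    have hf : ∀ a ∈ List.ofFn fun i => (f i : R), a ∈ s := by
      intro a ha
      obtain ⟨i, rfl⟩ := List.mem_ofFn.1 ha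
      exact (f i).2
    have h1 := List.prod_sub_map_prod_mem (I := I) z _ fun a ha => (hz a (hf a ha)).2
    rw [hn (List.map z _) (by simp) (by
      intro a ha
      obtain ⟨b, hb, rfl⟩ := List.mem_map.1 ha
      exact Finset.mem_image_of_mem z (hf b hb)), sub_zero] at h1
    exact h1)
  refine ⟨m * n, fun l hl h => ?_⟩
  obtain ⟨l', h1, h2, h3⟩ := List.exists_prod_eq_of_finset_pow n m l hl h
  rw [← h3, hm l' h1 h2]

theorem isLocallyNilpotentIdeal_bot : IsLocallyNilpotentIdeal (⊥ : TwoSidedIdeal R) := by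
  intro s hs
  refine ⟨1, fun l hl h => ?_⟩
  obtain ⟨a, rfl⟩ := List.length_eq_one_iff.1 hl
  simpa using TwoSidedIdeal.mem_bot _ |>.1 (hs a (h a (by simp)))

/-- By `sup`, the union of the locally nilpotent ideals is itself an ideal. -/
theorem mem_levitzkiRadical {a : R} :
    a ∈ levitzkiRadical R ↔ ∃ I : TwoSidedIdeal R, IsLocallyNilpotentIdeal I ∧ a ∈ I := by
  constructor
  · let K : TwoSidedIdeal R := .mk' {a | ∃ I : TwoSidedIdeal R, IsLocallyNilpotentIdeal I ∧ a ∈ I}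
      ⟨⊥, isLocallyNilpotentIdeal_bot, TwoSidedIdeal.zero_mem _⟩
      (by
        rintro x y ⟨I, hI, hx⟩ ⟨J, hJ, hy⟩
        exact ⟨I ⊔ J, hI.sup hJ,
          (I ⊔ J).add_mem (TwoSidedIdeal.mem_sup_left hx) (TwoSidedIdeal.mem_sup_right hy)⟩)
      (by rintro x ⟨I, hI, hx⟩; exact ⟨I, hI, I.neg_mem hx⟩)
      (by rintro x y ⟨I, hI, hy⟩; exact ⟨I, hI, I.mul_mem_left _ _ hy⟩)
      (by rintro x y ⟨I, hI, hx⟩; exact ⟨I, hI, I.mul_mem_right _ _ hx⟩)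
    have hK : levitzkiRadical R ≤ K :=
      sSup_le fun I hI x hx => (TwoSidedIdeal.mem_mk' _ _ _ _ _ _ x).2 ⟨I, hI, hx⟩
    exact fun ha => (TwoSidedIdeal.mem_mk' _ _ _ _ _ _ a).1 (hK ha)
  · rintro ⟨I, hI, ha⟩
    exact le_sSup (a := I) hI ha

theorem isLocallyNilpotentIdeal_levitzkiRadical :
    IsLocallyNilpotentIdeal (levitzkiRadical R) := by
  classical
  intro s hs
  have : ∃ I : TwoSidedIdeal R, IsLocallyNilpotentIdeal I ∧ ∀ a ∈ s, a ∈ I := by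
    induction s using Finset.induction_on with
    | empty => exact ⟨⊥, isLocallyNilpotentIdeal_bot, by simp⟩
    | insert b s _ ih =>
      obtain ⟨I, hI, h⟩ := ih fun a ha => hs a (Finset.mem_insert_of_mem ha)
      obtain ⟨J, hJ, hb⟩ := mem_levitzkiRadical.1 (hs b (Finset.mem_insert_self b s))
      refine ⟨I ⊔ J, hI.sup hJ, fun a ha => ?_⟩
      rcases Finset.mem_insert.1 ha with rfl | ha
      · exact TwoSidedIdeal.mem_sup_right hb
      · exact TwoSidedIdeal.mem_sup_left (h a ha)
  obtain ⟨I, hI, h⟩ := this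
  exact hI s h

end LocallyNilpotent

/-! ### Deleting twists by compatibility. -/

namespace IsCompatible

variable {R : Type*} [Ring R] {α : R →+* R}

theorem mul_map_mul_eq_zero_iff (hα : IsCompatible α) (a b c : R) :
    a * α b * c = 0 ↔ a * b * c = 0 := by
  rw [hα (a * α b) c, mul_assoc, ← map_mul, ← hα, mul_assoc]

theorem mul_pow_map_mul_eq_zero_iff (hα : IsCompatible α) (a b c : R) (i : ℕ) :
    a * (α ^ i) b * c = 0 ↔ a * b * c = 0 := by
  induction i with
  | zero => rfl
  | succ i ih => rw [pow_succ', ← ih]; exact hα.mul_map_mul_eq_zero_iff _ _ _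

/-- This is what makes compatibility pass to `R/L(R)` when `L(R) = Nil(R)`. -/
theorem isNilpotent_mul_map_iff (hα : IsCompatible α) (a b : R) :
    IsNilpotent (a * α b) ↔ IsNilpotent (a * b) := by
  -- The prefix `p` collects the factors whose twist is already removed.
  have key : ∀ (n : ℕ) (p : R), p * (a * α b) ^ n = 0 ↔ p * (a * b) ^ n = 0 := by
    intro n
    induction n with
    | zero => simp
    | succ n ih =>
      intro p
      rw [pow_succ', pow_succ', ← mul_assoc, ih, ← mul_assoc p, hα.mul_map_mul_eq_zero_iff,
        ← mul_assoc, ← mul_assoc]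
  refine exists_congr fun n => ?_
  simpa using key n 1

end IsCompatible

/-! ### The Armendariz property modulo an ideal with reduced quotient. -/

namespace TwoSidedIdeal

variable {R : Type*} [Ring R] {I : TwoSidedIdeal R}

theorem mul_mem_comm_of_semiprime (hI : ∀ a, a * a ∈ I → a ∈ I) {a b : R} (h : a * b ∈ I) :
    b * a ∈ I := by
  apply hI
  rw [show b * a * (b * a) = b * (a * b) * a by noncomm_ring]
  exact I.mul_mem_right _ _ (I.mul_mem_left _ _ h)

theorem mul_mul_mem_of_mul_mem (hI : ∀ a, a * a ∈ I → a ∈ I) {a b : R} (r : R) (h : a * b ∈ I) :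
    a * r * b ∈ I := by
  apply hI
  rw [show a * r * b * (a * r * b) = a * r * (b * a) * (r * b) by noncomm_ring]
  exact I.mul_mem_right _ _ (I.mul_mem_left _ _ (mul_mem_comm_of_semiprime hI h))

/-- The Armendariz property of skew polynomials modulo a compatible ideal with reduced
quotient. -/
theorem coeff_mul_coeff_mem {α : R →+* R} (hI : ∀ a, a * a ∈ I → a ∈ I)
    (hα : ∀ a b (i : ℕ), a * (α ^ i) b ∈ I ↔ a * b ∈ I) {a b : ℕ → R} {M : ℕ}
    (ha : ∀ i, M < i → a i = 0) (hb : ∀ i, M < i → b i = 0)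
    (h : ∀ k, k ≠ 0 → ∑ p ∈ Finset.HasAntidiagonal.antidiagonal k, a p.1 * (α ^ p.1) (b p.2) ∈ I) :
    ∀ i j, i + j ≠ 0 → a i * b j ∈ I := by
  -- Downward induction on `i + j`: beyond `2 * M` one of the two indices exceeds `M`.
  suffices H : ∀ d i j, i + j ≠ 0 → 2 * M + 1 ≤ i + j + d → a i * b j ∈ I from
    fun i j hij => H (2 * M + 1) i j hij (by omega)
  intro d
  induction d with
  | zero =>
    intro i j _ hij
    rcases lt_or_ge M i with hi | hi
    · rw [ha i hi, zero_mul]; exact I.zero_mem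
    · rw [hb j (by omega), mul_zero]; exact I.zero_mem
  | succ d ih =>
    intro i
    induction i using Nat.strong_induction_on with
    | _ i ihi =>
      intro j h0 hij
      -- After right multiplication by `b j`, terms with `p.1 < i` lie in `I` by the inner
      -- induction, and those with `p.1 > i` because `p.1 + j > i + j`.
      have hsum := I.mul_mem_right _ (b j) (h (i + j) h0)
      rw [← Finset.add_sum_erase _ _ (Finset.HasAntidiagonal.mem_antidiagonal.2 (rfl : (i, j).1 + (i, j).2 = _)),
        add_mul, Finset.sum_mul] at hsum
      have hrest : ∑ p ∈ (Finset.HasAntidiagonal.antidiagonal (i + j)).erase (i, j),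
          a p.1 * (α ^ p.1) (b p.2) * b j ∈ I := by
        refine I.finsetSum_mem _ _ fun p hp => ?_
        obtain ⟨hne, hp⟩ := Finset.mem_erase.1 hp
        rw [Finset.HasAntidiagonal.mem_antidiagonal] at hp
        rcases lt_trichotomy p.1 i with hlt | heq | hgt
        · exact I.mul_mem_right _ _ ((hα _ _ _).2 (ihi p.1 hlt p.2 (by omega) (by omega)))
        · exact absurd (Prod.ext heq (by simp; omega)) hne
        · exact mul_mul_mem_of_mul_mem hI _ (ih p.1 j (by omega) (by omega))
      have h1 : a i * (α ^ i) (b j) * b j ∈ I := by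
        have := I.sub_mem hsum hrest
        rwa [add_sub_cancel_right] at this
      -- Cycling and untwisting give `b j * a i * b j ∈ I`, hence `(a i * b j)² ∈ I`.
      have h2 := mul_mem_comm_of_semiprime hI h1
      rw [← mul_assoc, hα] at h2
      apply hI
      rw [mul_assoc (a i) (b j), ← mul_assoc (b j)]
      exact I.mul_mem_left _ _ h2

end TwoSidedIdeal
-- Coefficients and nilpotence in the skew polynomial ring.
namespace SkewPolyRing

variable {R : Type*} [Ring R] {α : R →+* R}

theorem ext {f g : SkewPolyRing α} (h : ∀ n, f.coeff n = g.coeff n) : f = g :=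
  SkewPolynomial.ext (R := R) h

@[simp]
theorem coeff_zero (n : ℕ) : (0 : SkewPolyRing α).coeff n = 0 := rfl

@[simp]
theorem coeff_add (f g : SkewPolyRing α) (n : ℕ) : (f + g).coeff n = f.coeff n + g.coeff n :=
  SkewPolynomial.coeff_add (R := R) f g n

@[simp]
theorem coeff_neg (f : SkewPolyRing α) (n : ℕ) : (-f).coeff n = -f.coeff n :=
  SkewPolynomial.coeff_neg (R := R) f n

@[simp]
theorem coeff_sub (f g : SkewPolyRing α) (n : ℕ) : (f - g).coeff n = f.coeff n - g.coeff n := by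
  rw [sub_eq_add_neg, coeff_add, coeff_neg, sub_eq_add_neg]

theorem coeff_C (a : R) (n : ℕ) : (C α a).coeff n = if n = 0 then a else 0 :=
  SkewPolynomial.coeff_C (R := R)

@[simp]
theorem coeff_C_zero (a : R) : (C α a).coeff 0 = a := by
  rw [coeff_C, if_pos rfl]

theorem coeff_C_of_ne_zero (a : R) {n : ℕ} (hn : n ≠ 0) : (C α a).coeff n = 0 := by
  rw [coeff_C, if_neg hn]

@[simp]
theorem coeff_one_zero : (1 : SkewPolyRing α).coeff 0 = 1 := by
  rw [← map_one (C α), coeff_C_zero]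

theorem coeff_mul (f g : SkewPolyRing α) (n : ℕ) :
    (f * g).coeff n = ∑ p ∈ Finset.HasAntidiagonal.antidiagonal n,
      f.coeff p.1 * (α ^ p.1) (g.coeff p.2) := by
  let _ := iterateAction α
  let e : ℕ × ℕ ↪ Multiplicative ℕ × Multiplicative ℕ :=
    ⟨fun p => (Multiplicative.ofAdd p.1, Multiplicative.ofAdd p.2), fun _ _ h => h⟩
  refine (SkewMonoidAlgebra.coeff_mul_antidiagonal_of_finset (k := R) (G := Multiplicative ℕ)
    f g (Multiplicative.ofAdd n) ((Finset.HasAntidiagonal.antidiagonal n).map e) ?_).trans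
    (Finset.sum_map _ _ _)
  intro p
  rw [Finset.mem_map]
  constructor
  · rintro ⟨q, hq, rfl⟩
    exact Finset.HasAntidiagonal.mem_antidiagonal.1 hq
  · intro h
    exact ⟨(p.1.toAdd, p.2.toAdd), Finset.HasAntidiagonal.mem_antidiagonal.2 h, rfl⟩

theorem coeff_mul_zero (f g : SkewPolyRing α) : (f * g).coeff 0 = f.coeff 0 * g.coeff 0 := by
  rw [coeff_mul, Finset.Nat.antidiagonal_zero, Finset.sum_singleton]; rfl

theorem coeff_C_mul (a : R) (f : SkewPolyRing α) (n : ℕ) :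
    (C α a * f).coeff n = a * f.coeff n := by
  rw [coeff_mul, Finset.sum_eq_single (0, n)]
  · rw [coeff_C_zero]; rfl
  · rintro ⟨i, j⟩ hp hne
    have : i ≠ 0 := by
      rintro rfl
      exact hne (by simpa using hp)
    rw [coeff_C_of_ne_zero _ this, zero_mul]
  · simp

theorem coeff_X (n : ℕ) : (X α).coeff n = if 1 = n then 1 else 0 :=
  SkewPolynomial.coeff_X (R := R)

@[simp]
theorem coeff_mul_X_zero (f : SkewPolyRing α) : (f * X α).coeff 0 = 0 := by
  rw [coeff_mul_zero, coeff_X]; simp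

@[simp]
theorem coeff_mul_X_succ (f : SkewPolyRing α) (n : ℕ) :
    (f * X α).coeff (n + 1) = f.coeff n := by
  rw [coeff_mul, Finset.sum_eq_single (n, 1)]
  · simp [coeff_X]
  · rintro ⟨i, j⟩ hp hne
    have : 1 ≠ j := by
      rintro rfl
      exact hne (by simpa using hp)
    rw [coeff_X, if_neg this, map_zero, mul_zero]
  · simp

theorem finite_support_coeff (f : SkewPolyRing α) : {n | f.coeff n ≠ 0}.Finite :=
  (SkewPolynomial.support (R := R) f).finite_toSet.subset fun _ hn =>
    SkewPolynomial.mem_support_iff.2 hn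

theorem exists_coeff_eq_zero (f : SkewPolyRing α) : ∃ M, ∀ n, M < n → f.coeff n = 0 := by
  obtain ⟨M, hM⟩ := f.finite_support_coeff.bddAbove
  exact ⟨M, fun n hn => by_contra fun h => (hM h).not_gt hn⟩

theorem exists_eq_C_add_mul_X (f : SkewPolyRing α) :
    ∃ g : SkewPolyRing α, (∀ n, g.coeff n = f.coeff (n + 1)) ∧ f = C α (f.coeff 0) + g * X α := by
  obtain ⟨M, hM⟩ := f.exists_coeff_eq_zero
  let g : SkewPolyRing α := ∑ i ∈ Finset.range (M + 1), C α (f.coeff (i + 1)) * X α ^ i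
  have hcoeff : ∀ (s : Finset ℕ) (F : ℕ → SkewPolyRing α) (n : ℕ),
      (∑ i ∈ s, F i).coeff n = ∑ i ∈ s, (F i).coeff n := fun s F n =>
    map_sum (AddMonoidHom.mk' (fun f : SkewPolyRing α => f.coeff n) fun f g => coeff_add f g n) F s
  have hg : ∀ n, g.coeff n = f.coeff (n + 1) := by
    intro n
    rw [hcoeff]
    simp only [coeff_C_mul_X_pow, Finset.sum_ite_eq', Finset.mem_range]
    split_ifs with h
    · rfl
    · exact (hM _ (by omega)).symm
  refine ⟨g, hg, ext fun n => ?_⟩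
  cases n with
  | zero => simp
  | succ n => simp [hg, coeff_C]

/-- Over a compatible endomorphism, a skew polynomial all of whose coefficients lie in a
locally nilpotent ideal is nilpotent. -/
theorem isNilpotent_of_coeff_mem (hα : IsCompatible α) {I : TwoSidedIdeal R}
    (hI : IsLocallyNilpotentIdeal I) {f : SkewPolyRing α} (hf : ∀ n, f.coeff n ∈ I) :
    IsNilpotent f := by
  classical
  -- Inserting `0` puts every coefficient, also outside the support, in one finite set.
  obtain ⟨n, hn⟩ := hI (insert 0 (f.finite_support_coeff.toFinset.image f.coeff)) (by
    intro a ha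
    rcases Finset.mem_insert.1 ha with rfl | ha
    · exact I.zero_mem
    · obtain ⟨i, -, rfl⟩ := Finset.mem_image.1 ha
      exact hf i)
  set S := insert 0 (f.finite_support_coeff.toFinset.image f.coeff)
  have hS : ∀ i, f.coeff i ∈ S := by
    intro i
    by_cases h : f.coeff i = 0
    · rw [h]; exact Finset.mem_insert_self _ _
    · exact Finset.mem_insert_of_mem (Finset.mem_image_of_mem _ (by simpa using h))
  -- The prefix `p` absorbs the coefficients peeled off the left of `f ^ n`; `α ^ i` is the twist
  -- accumulated from their degrees.
  have key : ∀ (n : ℕ) (p : R),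
      (∀ l : List R, l.length = n → (∀ a ∈ l, a ∈ S) → p * l.prod = 0) →
      ∀ i m, p * (α ^ i) ((f ^ n).coeff m) = 0 := by
    intro n
    induction n with
    | zero =>
      intro p hp i m
      have := hp [] rfl (by simp)
      rw [List.prod_nil, mul_one] at this
      rw [this, zero_mul]
    | succ n ih =>
      intro p hp i m
      rw [pow_succ', coeff_mul, map_sum, Finset.mul_sum]
      refine Finset.sum_eq_zero fun q _ => ?_
      have hpow (r : R) : (α ^ i) ((α ^ q.1) r) = (α ^ (i + q.1)) r := by rw [pow_add]; rfl
      rw [map_mul, ← mul_assoc, hpow]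
      refine ih _ (fun l hl h => ?_) _ _
      rw [hα.mul_pow_map_mul_eq_zero_iff, mul_assoc, ← List.prod_cons]
      exact hp _ (by simp [hl]) fun a ha => by
        rcases List.mem_cons.1 ha with rfl | ha
        · exact hS _
        · exact h a ha
  refine ⟨n, ext fun m => ?_⟩
  simpa using key n 1 (fun l hl h => by rw [hn l hl h, mul_zero]) 0 m

end SkewPolyRing

/-! ### Units and `Δ` of the skew polynomial ring. -/

section Units

variable {R : Type*} [Ring R] {α : R →+* R}

theorem IsWeaklyTwoPrimal.mem_levitzkiRadical_iff (hR : IsWeaklyTwoPrimal R) (a : R) :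
    a ∈ levitzkiRadical R ↔ IsNilpotent a :=
  (Set.ext_iff.1 hR a).symm

namespace SkewPolyRing

/-- The units of `R[x; α]` are the skew polynomials with invertible constant term and all other
coefficients in the Levitzki radical. -/
theorem isUnit_iff (hR : IsWeaklyTwoPrimal R) (hα : IsCompatible α) (f : SkewPolyRing α) :
    IsUnit f ↔ IsUnit (f.coeff 0) ∧ ∀ n, n ≠ 0 → f.coeff n ∈ levitzkiRadical R := by
  constructor
  · rintro ⟨u, rfl⟩
    set f := u.val
    set g := u⁻¹.val
    have hfg : f * g = C α 1 := by rw [map_one]; exact u.mul_inv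
    have hgf : g * f = C α 1 := by rw [map_one]; exact u.inv_mul
    have h1 : f.coeff 0 * g.coeff 0 = 1 := by rw [← coeff_mul_zero, hfg, coeff_C_zero]
    have h2 : g.coeff 0 * f.coeff 0 = 1 := by rw [← coeff_mul_zero, hgf, coeff_C_zero]
    refine ⟨⟨⟨_, _, h1, h2⟩, rfl⟩, fun n hn => ?_⟩
    have hsq : ∀ a : R, a * a ∈ levitzkiRadical R → a ∈ levitzkiRadical R := by
      simp only [hR.mem_levitzkiRadical_iff]
      intro a ha
      rw [← pow_two] at ha
      exact (IsNilpotent.pow_iff_pos two_ne_zero).1 ha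
    have hcomp : ∀ (a b : R) (i : ℕ),
        a * (α ^ i) b ∈ levitzkiRadical R ↔ a * b ∈ levitzkiRadical R := by
      simp only [hR.mem_levitzkiRadical_iff]
      intro a b i
      induction i with
      | zero => rfl
      | succ i ih => rw [pow_succ', ← ih]; exact hα.isNilpotent_mul_map_iff _ _
    obtain ⟨M, hM⟩ := f.exists_coeff_eq_zero
    obtain ⟨N, hN⟩ := g.exists_coeff_eq_zero
    -- The case `j = 0` gives `f.coeff n * g.coeff 0 ∈ L(R)`, and `f.coeff 0` inverts `g.coeff 0`.
    have h3 := TwoSidedIdeal.coeff_mul_coeff_mem hsq hcomp (M := max M N)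
      (fun i hi => hM i (lt_of_le_of_lt (le_max_left _ _) hi))
      (fun i hi => hN i (lt_of_le_of_lt (le_max_right _ _) hi))
      (fun k hk => by
        rw [← coeff_mul, hfg, coeff_C_of_ne_zero _ hk]; exact TwoSidedIdeal.zero_mem _)
      n 0 (by simpa using hn)
    have h4 := TwoSidedIdeal.mul_mem_right _ _ (f.coeff 0) h3
    rwa [mul_assoc, h2, mul_one] at h4
  · rintro ⟨⟨u, hu⟩, hf⟩
    have hnil : IsNilpotent (C α ↑u⁻¹ * (f - C α u)) := by
      refine isNilpotent_of_coeff_mem hα isLocallyNilpotentIdeal_levitzkiRadical fun n => ?_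
      rw [coeff_C_mul, coeff_sub]
      refine TwoSidedIdeal.mul_mem_left _ _ _ ?_
      by_cases hn : n = 0
      · rw [hn, coeff_C_zero, hu, sub_self]; exact TwoSidedIdeal.zero_mem _
      · rw [coeff_C_of_ne_zero _ hn, sub_zero]; exact hf n hn
    have h : C α u * (1 + C α ↑u⁻¹ * (f - C α u)) = f := by
      rw [mul_add, mul_one, ← mul_assoc, ← map_mul, Units.mul_inv, map_one, one_mul,
        add_sub_cancel]
    rw [← h]
    exact (u.isUnit.map (C α)).mul hnil.isUnit_one_add

theorem isUnit_C_iff (hR : IsWeaklyTwoPrimal R) (hα : IsCompatible α) (a : R) :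
    IsUnit (C α a) ↔ IsUnit a := by
  rw [isUnit_iff hR hα, coeff_C_zero]
  exact and_iff_left fun n hn => by
    rw [coeff_C_of_ne_zero _ hn]; exact TwoSidedIdeal.zero_mem _

theorem mem_deltaSet_iff (hR : IsWeaklyTwoPrimal R) (hα : IsCompatible α) (f : SkewPolyRing α) :
    f ∈ deltaSet (SkewPolyRing α) ↔
      f.coeff 0 ∈ deltaSet R ∧ ∀ n, n ≠ 0 → f.coeff n ∈ levitzkiRadical R := by
  constructor
  · intro hf
    refine ⟨fun u hu => ?_, fun n hn => ?_⟩
    · have := ((isUnit_iff hR hα _).1 (hf (C α u) ((isUnit_C_iff hR hα u).2 hu))).1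
      rwa [coeff_add, coeff_C_zero] at this
    -- Adding the unit `1` leaves the higher coefficients unchanged.
    · have := ((isUnit_iff hR hα _).1
        (hf (C α 1) ((isUnit_C_iff hR hα 1).2 isUnit_one))).2 n hn
      rwa [coeff_add, coeff_C_of_ne_zero _ hn, add_zero] at this
  · rintro ⟨h0, h⟩ u hu
    obtain ⟨hu0, hu⟩ := (isUnit_iff hR hα u).1 hu
    refine (isUnit_iff hR hα _).2 ⟨?_, fun n hn => ?_⟩
    · rw [coeff_add]; exact h0 _ hu0
    · rw [coeff_add]; exact TwoSidedIdeal.add_mem _ (h n hn) (hu n hn)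

end SkewPolyRing

/-- The elements `±1 + d` with `d ∈ Δ(R)` are always units. -/
theorem isWeaklyDeltaU_iff :
    IsWeaklyDeltaU R ↔ ∀ u : R, IsUnit u → u - 1 ∈ deltaSet R ∨ u + 1 ∈ deltaSet R := by
  constructor
  · intro h u hu
    obtain ⟨d, hd, rfl | rfl⟩ := (Set.ext_iff.1 h u).1 hu
    · left; rwa [add_sub_cancel_left]
    · right; rwa [neg_add_eq_sub, sub_add_cancel]
  · intro h
    ext u
    constructor
    · intro hu
      rcases h u hu with hd | hd
      · exact ⟨_, hd, Or.inl (by abel)⟩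
      · exact ⟨_, hd, Or.inr (by abel)⟩
    · rintro ⟨d, hd, rfl | rfl⟩
      · rw [add_comm]; exact hd 1 isUnit_one
      · rw [add_comm]; exact hd (-1) isUnit_one.neg

end Units

theorem mainTheorem7 {R : Type*} [Ring R] (α : R →+* R)
    (hR : IsWeaklyTwoPrimal R) (hα : IsCompatible α) :
    deltaSet (SkewPolyRing α) =
        {f : SkewPolyRing α | ∃ d ∈ deltaSet R, ∃ g : SkewPolyRing α,
          (∀ n : ℕ, g.coeff n ∈ levitzkiRadical R) ∧
            f = SkewPolyRing.C α d + g * SkewPolyRing.X α} ∧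
      (IsWeaklyDeltaU (SkewPolyRing α) ↔ IsWeaklyDeltaU R) := by
  have hmem := SkewPolyRing.mem_deltaSet_iff hR hα
  refine ⟨?_, ?_⟩
  · ext f
    rw [hmem]
    constructor
    · rintro ⟨h0, h⟩
      obtain ⟨g, hg, hf⟩ := f.exists_eq_C_add_mul_X
      exact ⟨f.coeff 0, h0, g, fun n => by rw [hg]; exact h _ n.succ_ne_zero, hf⟩
    · rintro ⟨d, hd, g, hg, rfl⟩
      refine ⟨by simpa using hd, fun n hn => ?_⟩
      obtain ⟨m, rfl⟩ := Nat.exists_eq_succ_of_ne_zero hn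
      simpa [SkewPolyRing.coeff_C] using hg m
  · rw [isWeaklyDeltaU_iff, isWeaklyDeltaU_iff, ← map_one (SkewPolyRing.C α)]
    constructor
    · intro h u hu
      rcases h _ ((SkewPolyRing.isUnit_C_iff hR hα u).2 hu) with hd | hd
      · left; simpa using ((hmem _).1 hd).1
      · right; simpa using ((hmem _).1 hd).1
    · intro h f hf
      obtain ⟨h0, hn⟩ := (SkewPolyRing.isUnit_iff hR hα f).1 hf
      rcases h _ h0 with hd | hd
      · refine Or.inl ((hmem _).2 ⟨by simpa using hd, fun n h => ?_⟩)
        rw [SkewPolyRing.coeff_sub, SkewPolyRing.coeff_C_of_ne_zero _ h, sub_zero]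
        exact hn n h
      · refine Or.inr ((hmem _).2 ⟨by simpa using hd, fun n h => ?_⟩)
        rw [SkewPolyRing.coeff_add, SkewPolyRing.coeff_C_of_ne_zero _ h, add_zero]
        exact hn n h
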